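/- Consider the stochastic $N$-agent $K$-armed bandit problem ($N,K\ge 1$). An environment is a probability distribution on utility matrices in $[0,1]^{K\times N}$, with mean matrix $u$; the matrices $u_1,u_2,\dots$ are drawn i.i.d. from it, and $u_{t,i,n}$ is the utility of agent $n$ for arm $i$ in round $t$. In round $t$ the learner chooses, depending on the past observations and possibly at random, a distribution $p_t$ in the simplex $\Delta_K$, draws an arm $i_t\sim p_t$ and observes only the utilities $u_{t,i_t,n}$, $n=1,\dots,N$. The Nash social welfare of $\mu\in[0,1]^N$ is $\mathrm{NSW}(\mu)=\prod_{n=1}^N\mu_n^{1/N}$, and the expected regret over $T$ rounds is $$\mathrm{Reg}_T=T\cdot\max_{p\in\Delta_K}\mathrm{NSW}(u^\top p)-\mathbb E\Big[\sum_{t=1}^T\mathrm{NSW}(u^\top p_t)\Big].$$ Theorem. There is a universal constant $c>0$ such that for all integers $N,K\ge1$ with $N\ge\ln K$ there is a $T_0=T_0(N,K)$ such that, for every $T\ge T_0$ and every algorithm, there is a stochastic environment in which the expected regret of this algorithm satisfies $$\mathrm{Reg}_T\ \ge\ c\,\frac{(\ln K)^3}{N^3}\,K^{1/N}\,T^{(N-1)/N}.$$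 Moreover, the environment can be chosen with a single hidden arm: for some arm $a$ and some $\varepsilon\in(0,1]$, the mean utility of the first agent is $\varepsilon$ for arm $a$ and $0$ for every other arm, and all other agents have constant utility $1$. -/

import Mathlib

open MeasureTheory ProbabilityTheory
open scoped ENNReal

namespace NashBandit

/-- The Nash social welfare of `N` expected utilities: their geometric mean. -/
noncomputable def nsw {N : ℕ} (μ : Fin N → ℝ) : ℝ :=
  ∏ n, μ n ^ ((1 : ℝ) / N)

/-- The simplex of probability distributions over the `K` arms. -/
abbrev Strategy (K : ℕ) : Type := stdSimplex ℝ (Fin K)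

/-- The record of one round: the distribution chosen by the learner, the sampled arm, and the
observed utilities (one per agent) of that arm. -/
abbrev Round (K N : ℕ) : Type := Strategy K × (Fin K × (Fin N → unitInterval))

/-- A stochastic environment: the utility matrices `u_t ∈ [0,1]^{K × N}` are i.i.d. draws
from `law`; entry `u i n` is the utility of agent `n` for arm `i`. -/
structure StochasticEnvironment (K N : ℕ) where
  law : Measure (Fin K → Fin N → unitInterval)
  isProbabilityMeasure_law : IsProbabilityMeasure law

attribute [instance] StochasticEnvironment.isProbabilityMeasure_law

/-- The mean utility matrix of an environment. -/
noncomputable def StochasticEnvironment.mean {K N : ℕ} (E : StochasticEnvironment K N)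
    (i : Fin K) (n : Fin N) : ℝ :=
  ∫ u, (u i n : ℝ) ∂E.law

/-- A (possibly randomized) bandit algorithm: after `t` completed rounds, the next distribution
over the arms is drawn from a law that depends measurably on the record of these rounds. -/
structure BanditAlgorithm (K N : ℕ) where
  policy : (t : ℕ) → Kernel (Fin t → Round K N) (Strategy K)
  isMarkovKernel_policy : ∀ t, IsMarkovKernel (policy t)

attribute [instance] BanditAlgorithm.isMarkovKernel_policy

/-- The vector `uᵀ p` of expected utilities of the agents under the strategy `p`. -/
noncomputable def expectedUtility {K N : ℕ} (u : Fin K → Fin N → ℝ) (p : Strategy K)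
    (n : Fin N) : ℝ :=
  ∑ i, p.1 i * u i n

/-- Sampling an arm from a strategy. -/
noncomputable def sampleArm (K : ℕ) : Kernel (Strategy K) (Fin K) where
  toFun p := ∑ i, ENNReal.ofReal (p.1 i) • Measure.dirac i
  measurable' := by
    refine Measure.measurable_of_measurable_coe _ fun s hs => ?_
    simp only [Measure.coe_finsetSum, Finset.sum_apply, Measure.smul_apply, smul_eq_mul]
    refine Finset.measurable_sum _ fun i _ => Measurable.mul_const ?_ _
    exact ((measurable_pi_apply i).comp measurable_subtype_coe).ennreal_ofReal

instance (K : ℕ) : IsMarkovKernel (sampleArm K) where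
  isProbabilityMeasure p := by
    constructor
    have h : sampleArm K p = ∑ i, ENNReal.ofReal (p.1 i) • Measure.dirac i := rfl
    simp only [h, Measure.coe_finsetSum, Finset.sum_apply, Measure.smul_apply, smul_eq_mul,
      measure_univ, mul_one]
    rw [← ENNReal.ofReal_sum_of_nonneg fun i _ => p.2.1 i, p.2.2, ENNReal.ofReal_one]

/-- Bandit feedback: only the row of the utility matrix at the played arm is observed. -/
def observe {K N : ℕ} (x : Fin K × (Fin K → Fin N → unitInterval)) :
    Fin K × (Fin N → unitInterval) :=
  (x.1, x.2 x.1)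

theorem measurable_observe {K N : ℕ} : Measurable (observe (K := K) (N := N)) :=
  measurable_fst.prodMk
    (measurable_from_prod_countable_right fun i => measurable_pi_apply i)

/-- Given the learner's strategy, draw the arm from it and, independently, the utility matrix
from the environment; return the arm and the observed utilities. -/
noncomputable def StochasticEnvironment.play {K N : ℕ} (E : StochasticEnvironment K N) :
    Kernel (Strategy K) (Fin K × (Fin N → unitInterval)) :=
  (sampleArm K ×ₖ Kernel.const (Strategy K) E.law).map observe

instance {K N : ℕ} (E : StochasticEnvironment K N) : IsMarkovKernel E.play :=
  Kernel.IsMarkovKernel.map _ measurable_observe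

/-- The law of the next round given the record of the first `t` rounds. -/
noncomputable def nextRound {K N : ℕ} (A : BanditAlgorithm K N) (E : StochasticEnvironment K N)
    (t : ℕ) : Kernel (Fin t → Round K N) (Round K N) :=
  A.policy t ⊗ₖ Kernel.prodMkLeft (Fin t → Round K N) E.play

instance {K N : ℕ} (A : BanditAlgorithm K N) (E : StochasticEnvironment K N) (t : ℕ) :
    IsMarkovKernel (nextRound A E t) := by
  unfold nextRound; infer_instance

/-- Append a round to a record of `t` rounds. -/
def appendRound {K N : ℕ} (t : ℕ) (x : (Fin t → Round K N) × Round K N) :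
    Fin (t + 1) → Round K N :=
  Fin.snoc (α := fun _ => Round K N) x.1 x.2

theorem measurable_appendRound {K N : ℕ} (t : ℕ) :
    Measurable (appendRound (K := K) (N := N) t) := by
  refine measurable_pi_lambda _ fun j => ?_
  refine Fin.lastCases ?_ (fun j => ?_) j
  · simpa only [appendRound, Fin.snoc_last] using measurable_snd
  · simpa only [appendRound, Fin.snoc_castSucc] using
      (measurable_pi_iff.1 measurable_fst j)

/-- The law of the record of the first `t` rounds of the interaction. -/
noncomputable def historyLaw {K N : ℕ} (A : BanditAlgorithm K N)
    (E : StochasticEnvironment K N) : (t : ℕ) → Measure (Fin t → Round K N)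
  | 0 => Measure.dirac (fun j => j.elim0)
  | t + 1 => (historyLaw A E t ⊗ₘ nextRound A E t).map (appendRound t)

instance {K N : ℕ} (A : BanditAlgorithm K N) (E : StochasticEnvironment K N) (t : ℕ) :
    IsProbabilityMeasure (historyLaw A E t) := by
  induction t with
  | zero => unfold historyLaw; infer_instance
  | succ t ih =>
    unfold historyLaw
    exact Measure.isProbabilityMeasure_map (measurable_appendRound t).aemeasurable

/-- The expected regret over `T` rounds with respect to the Nash social welfare:
`T · max_p NSW(uᵀ p) - 𝔼[∑_t NSW(uᵀ p_t)]`, where `u` is the mean utility matrix. -/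
noncomputable def regret {K N : ℕ} (A : BanditAlgorithm K N) (E : StochasticEnvironment K N)
    (T : ℕ) : ℝ :=
  T * (⨆ p : Strategy K, nsw (expectedUtility E.mean p)) -
    ∫ h, ∑ t, nsw (expectedUtility E.mean (h t).1) ∂(historyLaw A E T)

/-- The mean utilities of the instance with a hidden arm `a`: for the first agent (index `0`),
arm `a` has mean `ε` and all other arms have mean `0`; every other agent has constant
utility `1`. -/
def hiddenArmMean {K N : ℕ} (a : Fin K) (ε : ℝ) (i : Fin K) (n : Fin N) : ℝ :=
  if (n : ℕ) = 0 then (if i = a then ε else 0) else 1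

end NashBandit

open NashBandit

namespace NashBandit

variable {K N : ℕ}

/-! The hidden arm is compared with a null environment in which the first agent never gets anything.
There some arm `a` receives expected total mass at most `T / K`, so by concavity of `y ^ (1 / N)`
the expectation of `∑ p_t(a) ^ (1 / N)` is at most `T * K ^ (-1 / N)` (`integral_sum_rpow_le`).
Making `a` worth `ε` changes what the learner sees in a round only with probability `ε * p_t(a)`.
Summed over the rounds, the expectation of a `[0,1]`-valued statistic rises by at most `ε * T / K`
(`lintegral_historyLaw_hiddenArm_le`). Welfare in the hidden-arm environment is `ε ^ (1 / N) * p(a)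
^ (1 / N)`, so the regret is at least `ε ^ (1 / N) * T * (1 - K ^ (-1 / N) - ε * T / K)`. With `x =
ln K / N ≤ 1` the gap `1 - K ^ (-1 / N) = 1 - exp (-x)` is at least `x / 2`, and `ε` of order `x * K
/ T` gives a bound with `x ^ 2`, stronger than the required `x ^ 3`. -/

theorem lintegral_sampleArm (p : Strategy K) (f : Fin K → ℝ≥0∞) :
    ∫⁻ i, f i ∂sampleArm K p = ∑ i, ENNReal.ofReal (p.1 i) * f i := by
  have h : sampleArm K p = ∑ i, ENNReal.ofReal (p.1 i) • Measure.dirac i := rfl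
  rw [h, lintegral_finsetSum_measure]
  simp [lintegral_smul_measure]

theorem lintegral_play (E : StochasticEnvironment K N) (p : Strategy K)
    {f : Fin K × (Fin N → unitInterval) → ℝ≥0∞} (hf : Measurable f) :
    ∫⁻ x, f x ∂E.play p = ∑ i, ENNReal.ofReal (p.1 i) * ∫⁻ u, f (i, u i) ∂E.law := by
  rw [StochasticEnvironment.play, Kernel.lintegral_map _ measurable_observe _ hf,
    Kernel.prod_apply, Kernel.const_apply,
    lintegral_prod (fun x => f (observe x)) (hf.comp measurable_observe).aemeasurable,
    lintegral_sampleArm]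
  rfl

theorem lintegral_nextRound (A : BanditAlgorithm K N) (E : StochasticEnvironment K N) (t : ℕ)
    (h : Fin t → Round K N) {f : Round K N → ℝ≥0∞} (hf : Measurable f) :
    ∫⁻ r, f r ∂nextRound A E t h = ∫⁻ p, ∫⁻ x, f (p, x) ∂E.play p ∂A.policy t h := by
  rw [nextRound, Kernel.lintegral_compProd _ _ _ hf]
  rfl

theorem lintegral_historyLaw_succ (A : BanditAlgorithm K N) (E : StochasticEnvironment K N)
    (t : ℕ) {f : (Fin (t + 1) → Round K N) → ℝ≥0∞} (hf : Measurable f) :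
    ∫⁻ h, f h ∂historyLaw A E (t + 1) =
      ∫⁻ h, ∫⁻ r, f (appendRound t (h, r)) ∂nextRound A E t h ∂historyLaw A E t := by
  rw [historyLaw, lintegral_map hf (measurable_appendRound t),
    Measure.lintegral_compProd (f := fun x => f (appendRound t x)) (hf.comp (measurable_appendRound t))]

/-! ### Expected mass of an arm. -/

theorem measurable_strategy_apply (a : Fin K) : Measurable fun p : Strategy K => p.1 a :=
  (measurable_pi_apply a).comp measurable_subtype_coe

theorem measurable_history_strategy_apply (t : ℕ) (s : Fin t) (a : Fin K) :
    Measurable fun h : Fin t → Round K N => (h s).1.1 a :=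
  (measurable_strategy_apply a).comp (measurable_fst.comp (measurable_pi_apply s))

/-- The expected total probability that the learner puts on the arm `a` in the first `t` rounds. -/
noncomputable def expectedMass (A : BanditAlgorithm K N) (E : StochasticEnvironment K N)
    (a : Fin K) (t : ℕ) : ℝ≥0∞ :=
  ∫⁻ h, ∑ s, ENNReal.ofReal ((h s).1.1 a) ∂historyLaw A E t

theorem expectedMass_succ (A : BanditAlgorithm K N) (E : StochasticEnvironment K N)
    (a : Fin K) (t : ℕ) :
    expectedMass A E a (t + 1) = expectedMass A E a t +
      ∫⁻ h, ∫⁻ p, ENNReal.ofReal (p.1 a) ∂A.policy t h ∂historyLaw A E t := by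
  have hm (t : ℕ) : Measurable fun h : Fin t → Round K N =>
      ∑ s, ENNReal.ofReal ((h s).1.1 a) :=
    Finset.measurable_sum _ fun s _ => (measurable_history_strategy_apply t s a).ennreal_ofReal
  rw [expectedMass, lintegral_historyLaw_succ A E t (hm (t + 1)), expectedMass,
    ← lintegral_add_left (hm t)]
  refine lintegral_congr fun h => ?_
  have hr : Measurable fun r : Round K N => ENNReal.ofReal (r.1.1 a) :=
    ((measurable_strategy_apply a).comp measurable_fst).ennreal_ofReal
  simp only [Fin.sum_univ_castSucc, appendRound, Fin.snoc_castSucc, Fin.snoc_last]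
  rw [lintegral_add_left measurable_const, lintegral_const, measure_univ, mul_one,
    lintegral_nextRound A E t h hr]
  simp

theorem sum_expectedMass (A : BanditAlgorithm K N) (E : StochasticEnvironment K N) (t : ℕ) :
    ∑ a, expectedMass A E a t = t := by
  unfold expectedMass
  rw [← lintegral_finsetSum _ fun a _ => Finset.measurable_sum _ fun s _ =>
    (measurable_history_strategy_apply t s a).ennreal_ofReal]
  have h1 (h : Fin t → Round K N) : ∑ a, ∑ s, ENNReal.ofReal ((h s).1.1 a) = t := by
    rw [Finset.sum_comm]
    have (s : Fin t) : ∑ a, ENNReal.ofReal ((h s).1.1 a) = 1 := by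
      rw [← ENNReal.ofReal_sum_of_nonneg fun i _ => (h s).1.2.1 i, (h s).1.2.2, ENNReal.ofReal_one]
    simp [this]
  simp [h1]

/-- Pigeonhole: the masses of the arms sum to `t`, so the smallest is at most the average. -/
theorem exists_expectedMass_le (A : BanditAlgorithm K N) (E : StochasticEnvironment K N)
    (hK : 1 ≤ K) (t : ℕ) : ∃ a, (K : ℝ≥0∞) * expectedMass A E a t ≤ t := by
  have : NeZero K := ⟨by omega⟩
  obtain ⟨a, -, ha⟩ := Finset.exists_min_image Finset.univ (fun a => expectedMass A E a t)
    Finset.univ_nonempty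
  refine ⟨a, ?_⟩
  rw [← sum_expectedMass A E t]
  simpa using Finset.card_nsmul_le_sum Finset.univ (fun a => expectedMass A E a t) _ ha

/-! ### The null and hidden-arm environments, and their comparison. -/

/-- The utility matrix in which every agent but the first has utility `1`, and the first has
utility `v` for the arm `a` and `0` for all other arms. -/
def hiddenArmUtility (a : Fin K) (v : unitInterval) (i : Fin K) (n : Fin N) : unitInterval :=
  if (n : ℕ) = 0 then (if i = a then v else 0) else 1

/-- The environment in which the first agent never gets any utility. -/
noncomputable def nullEnvironment (K N : ℕ) : StochasticEnvironment K N where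
  law := Measure.dirac fun _ n => if (n : ℕ) = 0 then 0 else 1
  isProbabilityMeasure_law := inferInstance

/-- The environment in which the first agent's utility for the arm `a` is Bernoulli with
mean `ε`. -/
noncomputable def hiddenArmEnvironment (N : ℕ) (a : Fin K) (ε : unitInterval) :
    StochasticEnvironment K N where
  law := ENNReal.ofReal (1 - ε) • Measure.dirac (hiddenArmUtility a 0) +
    ENNReal.ofReal ε • Measure.dirac (hiddenArmUtility a 1)
  isProbabilityMeasure_law := by
    constructor
    simp only [Measure.add_apply, Measure.smul_apply, measure_univ, smul_eq_mul, mul_one]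
    rw [← ENNReal.ofReal_add (by linarith [ε.2.2]) ε.2.1]
    simp

theorem mean_hiddenArmEnvironment (a : Fin K) (ε : unitInterval) :
    (hiddenArmEnvironment N a ε).mean = hiddenArmMean a ε := by
  funext i n
  have hi (v : unitInterval) (r : ℝ) :
      Integrable (fun u : Fin K → Fin N → unitInterval => (u i n : ℝ))
        (ENNReal.ofReal r • Measure.dirac (hiddenArmUtility a v)) := by
    refine Integrable.smul_measure ?_ ENNReal.ofReal_ne_top
    exact integrable_dirac (by simp)
  rw [StochasticEnvironment.mean, hiddenArmEnvironment, integral_add_measure (hi _ _) (hi _ _),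
    integral_smul_measure, integral_smul_measure, integral_dirac, integral_dirac,
    ENNReal.toReal_ofReal (by linarith [ε.2.2]), ENNReal.toReal_ofReal ε.2.1]
  unfold hiddenArmUtility hiddenArmMean
  split_ifs <;> simp

/-- The observations agree unless arm `a` is drawn and its Bernoulli utility is `1`. This has
probability `ε * p(a)`, and there `f` is at most `1`. -/
theorem lintegral_play_hiddenArm_le (a : Fin K) (ε : unitInterval) (p : Strategy K)
    {f : Fin K × (Fin N → unitInterval) → ℝ≥0∞} (hf : Measurable f) (hf1 : ∀ x, f x ≤ 1) :
    ∫⁻ x, f x ∂(hiddenArmEnvironment N a ε).play p ≤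
      ∫⁻ x, f x ∂(nullEnvironment K N).play p +
        ENNReal.ofReal ε * ENNReal.ofReal (p.1 a) := by
  have hm (i : Fin K) : Measurable fun u : Fin K → Fin N → unitInterval => f (i, u i) :=
    hf.comp (measurable_const.prodMk (measurable_pi_apply i))
  have h1 : ENNReal.ofReal (1 - ε) + ENNReal.ofReal ε = 1 := by
    rw [← ENNReal.ofReal_add (by linarith [ε.2.2]) ε.2.1]
    simp
  have h2 : ENNReal.ofReal (1 - ε) ≤ 1 := by rw [← h1]; exact le_self_add
  rw [lintegral_play _ _ hf, lintegral_play _ _ hf]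
  have hs : ENNReal.ofReal ε * ENNReal.ofReal (p.1 a) =
      ∑ i, ENNReal.ofReal (p.1 i) * (if i = a then ENNReal.ofReal ε else 0) := by
    simp [mul_comm]
  rw [hs, ← Finset.sum_add_distrib]
  refine Finset.sum_le_sum fun i _ => ?_
  rw [← mul_add]
  gcongr
  simp only [hiddenArmEnvironment, nullEnvironment, lintegral_add_measure,
    lintegral_smul_measure, lintegral_dirac' _ (hm i), smul_eq_mul]
  have h0 : hiddenArmUtility a 0 i = fun n : Fin N => if (n : ℕ) = 0 then 0 else 1 := by
    funext n; simp [hiddenArmUtility]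
  rw [h0]
  by_cases hia : i = a
  · rw [if_pos hia]
    exact add_le_add (mul_le_of_le_one_left' h2) (mul_le_of_le_one_right' (hf1 _))
  · have h3 : hiddenArmUtility a 1 i = fun n : Fin N => if (n : ℕ) = 0 then 0 else 1 := by
      funext n; simp [hiddenArmUtility, hia]
    rw [h3, ← add_mul, h1, if_neg hia, one_mul, add_zero]

/-- The expectation of a `[0,1]`-valued statistic of the history exceeds its expectation in the
null environment by at most `ε` times the expected mass put on the arm `a` there. -/
theorem lintegral_historyLaw_hiddenArm_le (A : BanditAlgorithm K N) (a : Fin K)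
    (ε : unitInterval) (t : ℕ) {g : (Fin t → Round K N) → ℝ≥0∞} (hg : Measurable g)
    (hg1 : ∀ h, g h ≤ 1) :
    ∫⁻ h, g h ∂historyLaw A (hiddenArmEnvironment N a ε) t ≤
      ∫⁻ h, g h ∂historyLaw A (nullEnvironment K N) t +
        ENNReal.ofReal ε * expectedMass A (nullEnvironment K N) a t := by
  induction t with
  | zero => exact le_self_add
  | succ t ih =>
    have hga : Measurable fun x : (Fin t → Round K N) × Round K N => g (appendRound t x) :=
      hg.comp (measurable_appendRound t)
    have hgh (h : Fin t → Round K N) : Measurable fun r => g (appendRound t (h, r)) :=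
      hga.comp measurable_prodMk_left
    have hp : Measurable fun p : Strategy K => ENNReal.ofReal (p.1 a) :=
      (measurable_strategy_apply a).ennreal_ofReal
    rw [lintegral_historyLaw_succ _ _ _ hg, lintegral_historyLaw_succ _ _ _ hg,
      expectedMass_succ, mul_add]
    -- Hybrid argument: the induction hypothesis is applied to `g` averaged over a last round in the
    -- hidden-arm environment. The remaining exchange of that round takes place under the null
    -- history law, so all mass is counted in the null environment.
    refine (ih (hga.lintegral_kernel_prod_right' (κ := nextRound A _ t)) fun h => ?_).trans ?_
    · refine (lintegral_mono fun r => hg1 _).trans ?_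
      simp
    rw [add_comm (ENNReal.ofReal ε * _), ← add_assoc]
    gcongr
    rw [← lintegral_const_mul _ (hp.lintegral_kernel (κ := A.policy t)),
      ← lintegral_add_left (hga.lintegral_kernel_prod_right' (κ := nextRound A _ t))]
    refine lintegral_mono fun h => ?_
    rw [lintegral_nextRound _ _ _ _ (hgh h), lintegral_nextRound _ _ _ _ (hgh h),
      ← lintegral_const_mul _ hp, ← lintegral_add_right _ (hp.const_mul _)]
    exact lintegral_mono fun p => lintegral_play_hiddenArm_le a ε p
      ((hgh h).comp measurable_prodMk_left) fun x => hg1 _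

theorem integral_historyLaw_hiddenArm_le (A : BanditAlgorithm K N) (a : Fin K)
    (ε : unitInterval) (t : ℕ) {g : (Fin t → Round K N) → ℝ} (hg : Measurable g)
    (hg0 : ∀ h, 0 ≤ g h) (hg1 : ∀ h, g h ≤ 1) :
    ∫ h, g h ∂historyLaw A (hiddenArmEnvironment N a ε) t ≤
      ∫ h, g h ∂historyLaw A (nullEnvironment K N) t +
        ε * (expectedMass A (nullEnvironment K N) a t).toReal := by
  have hfin : expectedMass A (nullEnvironment K N) a t ≠ ⊤ := by
    refine ne_top_of_le_ne_top (ENNReal.natCast_ne_top t) ?_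
    rw [← sum_expectedMass A (nullEnvironment K N) t]
    exact Finset.single_le_sum (f := fun a => expectedMass A (nullEnvironment K N) a t)
      (fun _ _ => zero_le) (Finset.mem_univ a)
  have hne (E : StochasticEnvironment K N) :
      ∫⁻ h, ENNReal.ofReal (g h) ∂historyLaw A E t ≠ ⊤ := by
    refine ne_top_of_le_ne_top ENNReal.one_ne_top
      ((lintegral_mono fun h => ENNReal.ofReal_le_one.2 (hg1 h)).trans ?_)
    simp
  have key := lintegral_historyLaw_hiddenArm_le A a ε t hg.ennreal_ofReal
    fun h => ENNReal.ofReal_le_one.2 (hg1 h)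
  rw [integral_eq_lintegral_of_nonneg_ae (.of_forall hg0) hg.aestronglyMeasurable,
    integral_eq_lintegral_of_nonneg_ae (.of_forall hg0) hg.aestronglyMeasurable]
  have hmul := ENNReal.mul_ne_top (ENNReal.ofReal_ne_top (r := (ε : ℝ))) hfin
  refine (ENNReal.toReal_mono (ENNReal.add_ne_top.2 ⟨hne _, hmul⟩) key).trans ?_
  rw [ENNReal.toReal_add (hne _) hmul, ENNReal.toReal_mul, ENNReal.toReal_ofReal ε.2.1]

/-! ### Regret in the hidden-arm environment. -/

theorem integrable_history_of_bounded (A : BanditAlgorithm K N) (E : StochasticEnvironment K N)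
    (t : ℕ) {g : (Fin t → Round K N) → ℝ} (hg : Measurable g) (C : ℝ) (hg0 : ∀ h, 0 ≤ g h)
    (hgC : ∀ h, g h ≤ C) : Integrable g (historyLaw A E t) :=
  .of_bound hg.aestronglyMeasurable C
    (.of_forall fun h => by rw [Real.norm_of_nonneg (hg0 h)]; exact hgC h)

theorem strategy_apply_nonneg (p : Strategy K) (a : Fin K) : 0 ≤ p.1 a := p.2.1 a

theorem strategy_apply_le_one (p : Strategy K) (a : Fin K) : p.1 a ≤ 1 := by
  rw [← p.2.2]
  exact Finset.single_le_sum (fun i _ => p.2.1 i) (Finset.mem_univ a)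

theorem toReal_expectedMass (A : BanditAlgorithm K N) (E : StochasticEnvironment K N)
    (a : Fin K) (t : ℕ) :
    (expectedMass A E a t).toReal = ∫ h, ∑ s, (h s).1.1 a ∂historyLaw A E t := by
  rw [integral_eq_lintegral_of_nonneg_ae
    (.of_forall fun h => Finset.sum_nonneg fun s _ => strategy_apply_nonneg _ a)
    (Finset.measurable_sum _ fun s _ =>
      measurable_history_strategy_apply t s a).aestronglyMeasurable, expectedMass]
  simp_rw [ENNReal.ofReal_sum_of_nonneg fun s _ => strategy_apply_nonneg _ a]

theorem nsw_expectedUtility_hiddenArmMean (hN : 1 ≤ N) (a : Fin K) {ε : ℝ} (hε : 0 ≤ ε)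
    (p : Strategy K) :
    nsw (expectedUtility (N := N) (hiddenArmMean a ε) p) =
      ε ^ ((1 : ℝ) / N) * p.1 a ^ ((1 : ℝ) / N) := by
  obtain ⟨M, rfl⟩ : ∃ M, N = M + 1 := ⟨N - 1, by omega⟩
  rw [nsw, Fin.prod_univ_succ, ← Real.mul_rpow hε (strategy_apply_nonneg p a)]
  simp [expectedUtility, hiddenArmMean, mul_comm, p.2.2]

/-- Bernoulli's inequality around `1 / K`. -/
theorem rpow_le_tangent (hN : 1 ≤ N) (hK : 1 ≤ K) {y : ℝ} (hy : 0 ≤ y) :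
    y ^ ((1 : ℝ) / N) ≤ (K : ℝ) ^ (-((1 : ℝ) / N)) * (1 + 1 / N * (K * y - 1)) := by
  have hK0 : (0 : ℝ) < K := by exact_mod_cast hK
  have hN1 : (1 : ℝ) ≤ N := by exact_mod_cast hN
  have h := rpow_one_add_le_one_add_mul_self (s := K * y - 1) (p := 1 / N)
    (by nlinarith [mul_nonneg hK0.le hy]) (by positivity)
    (by rw [div_le_one (by linarith)]; exact hN1)
  rw [add_sub_cancel, Real.mul_rpow hK0.le hy] at h
  calc y ^ ((1 : ℝ) / N)
      = (K : ℝ) ^ (-((1 : ℝ) / N)) * ((K : ℝ) ^ ((1 : ℝ) / N) * y ^ ((1 : ℝ) / N)) := by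
        rw [← mul_assoc, ← Real.rpow_add hK0]; simp
    _ ≤ _ := by gcongr

/-- The optimal welfare is bounded below by that of always playing `a`, namely `ε ^ (1 / N)`. -/
theorem le_regret_hiddenArm (hN : 1 ≤ N) (A : BanditAlgorithm K N) (a : Fin K)
    (ε : unitInterval) (T : ℕ) :
    (ε : ℝ) ^ ((1 : ℝ) / N) * (T - ∫ h, ∑ t, (h t).1.1 a ^ ((1 : ℝ) / N)
        ∂historyLaw A (hiddenArmEnvironment N a ε) T) ≤
      regret A (hiddenArmEnvironment N a ε) T := by
  rw [regret, mean_hiddenArmEnvironment]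
  simp_rw [nsw_expectedUtility_hiddenArmMean hN a ε.2.1, ← Finset.mul_sum]
  rw [integral_const_mul, mul_sub, mul_comm _ (T : ℝ)]
  gcongr
  have hε : (0 : ℝ) ≤ (ε : ℝ) ^ ((1 : ℝ) / N) := Real.rpow_nonneg ε.2.1 _
  -- A real supremum over an unbounded range is `0` by convention, so boundedness is needed before a
  -- single value can bound it from below.
  have hb : BddAbove (Set.range fun p : Strategy K =>
      (ε : ℝ) ^ ((1 : ℝ) / N) * p.1 a ^ ((1 : ℝ) / N)) := by
    refine ⟨(ε : ℝ) ^ ((1 : ℝ) / N), ?_⟩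
    rintro _ ⟨p, rfl⟩
    exact mul_le_of_le_one_right hε (Real.rpow_le_one (strategy_apply_nonneg p a)
      (strategy_apply_le_one p a) (by positivity))
  refine le_trans (le_of_eq ?_) (le_ciSup hb ⟨Pi.single a 1, single_mem_stdSimplex ℝ a⟩)
  simp

theorem sum_strategy_rpow_le {T : ℕ} (h : Fin T → Round K N) (a : Fin K) :
    ∑ t, (h t).1.1 a ^ ((1 : ℝ) / N) ≤ T := by
  have := Finset.sum_le_card_nsmul Finset.univ (fun t => (h t).1.1 a ^ ((1 : ℝ) / N)) 1
    fun t _ => Real.rpow_le_one (strategy_apply_nonneg _ a) (strategy_apply_le_one _ a)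
      (by positivity)
  simpa using this

theorem sum_strategy_rpow_nonneg {T : ℕ} (h : Fin T → Round K N) (a : Fin K) :
    0 ≤ ∑ t, (h t).1.1 a ^ ((1 : ℝ) / N) :=
  Finset.sum_nonneg fun _ _ => Real.rpow_nonneg (strategy_apply_nonneg _ a) _

theorem measurable_sum_strategy_rpow (T : ℕ) (a : Fin K) :
    Measurable fun h : Fin T → Round K N => ∑ t, (h t).1.1 a ^ ((1 : ℝ) / N) :=
  Finset.measurable_sum _ fun t _ => (measurable_history_strategy_apply T t a).pow_const _

theorem integrable_sum_strategy_rpow (A : BanditAlgorithm K N) (E : StochasticEnvironment K N)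
    (T : ℕ) (a : Fin K) :
    Integrable (fun h => ∑ t, (h t).1.1 a ^ ((1 : ℝ) / N)) (historyLaw A E T) :=
  integrable_history_of_bounded A E T (measurable_sum_strategy_rpow T a) T
    (fun h => sum_strategy_rpow_nonneg h a) fun h => sum_strategy_rpow_le h a

theorem regret_hiddenArm_nonneg (hN : 1 ≤ N) (A : BanditAlgorithm K N) (a : Fin K)
    (ε : unitInterval) (T : ℕ) : 0 ≤ regret A (hiddenArmEnvironment N a ε) T := by
  refine le_trans (mul_nonneg (Real.rpow_nonneg ε.2.1 _) (sub_nonneg.2 ?_))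
    (le_regret_hiddenArm hN A a ε T)
  refine (integral_mono (integrable_sum_strategy_rpow A _ T a) (integrable_const (T : ℝ))
    fun h => sum_strategy_rpow_le h a).trans ?_
  simp

/-- Jensen's inequality via the tangent of `y ^ (1 / N)` at `1 / K`: by `ha` the linear term,
averaged over rounds and histories, is nonpositive. -/
theorem integral_sum_rpow_le (hN : 1 ≤ N) (hK : 1 ≤ K) (A : BanditAlgorithm K N)
    (E : StochasticEnvironment K N) (a : Fin K) (T : ℕ)
    (ha : K * (expectedMass A E a T).toReal ≤ T) :
    ∫ h, ∑ t, (h t).1.1 a ^ ((1 : ℝ) / N) ∂historyLaw A E T ≤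
      (K : ℝ) ^ (-((1 : ℝ) / N)) * T := by
  have hint : Integrable (fun h => ∑ t, (h t).1.1 a) (historyLaw A E T) := by
    refine integrable_history_of_bounded A E T
      (Finset.measurable_sum _ fun t _ => measurable_history_strategy_apply T t a) T
      (fun h => Finset.sum_nonneg fun t _ => strategy_apply_nonneg _ a) fun h => ?_
    simpa using Finset.sum_le_card_nsmul Finset.univ (fun t => (h t).1.1 a) 1
      fun t _ => strategy_apply_le_one _ a
  have hpt (h : Fin T → Round K N) : ∑ t, (h t).1.1 a ^ ((1 : ℝ) / N) ≤
      (K : ℝ) ^ (-((1 : ℝ) / N)) * (T * (1 - 1 / N) + 1 / N * K * ∑ t, (h t).1.1 a) := by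
    refine (Finset.sum_le_sum fun t _ =>
      rpow_le_tangent hN hK (strategy_apply_nonneg (h t).1 a)).trans (le_of_eq ?_)
    rw [← Finset.mul_sum, Finset.sum_add_distrib, ← Finset.mul_sum, Finset.sum_sub_distrib,
      ← Finset.mul_sum, Finset.sum_const, Finset.card_univ, Fintype.card_fin]
    simp only [nsmul_eq_mul]
    ring
  refine (integral_mono (integrable_sum_strategy_rpow A E T a)
    (((integrable_const _).add (hint.const_mul _)).const_mul _) hpt).trans ?_
  simp only [Pi.add_apply]
  rw [integral_const_mul _ (fun _ => _ + _),
    integral_add (integrable_const _) (hint.const_mul _),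
    integral_const, integral_const_mul, ← toReal_expectedMass]
  gcongr
  have : (1 : ℝ) / N * (K * (expectedMass A E a T).toReal) ≤ 1 / N * T := by gcongr
  simp only [probReal_univ, one_smul]
  linarith

theorem exists_le_regret_hiddenArm (hN : 1 ≤ N) (hK : 1 ≤ K) (A : BanditAlgorithm K N)
    (ε : unitInterval) {T : ℕ} (hT : 1 ≤ T) :
    ∃ a : Fin K, (ε : ℝ) ^ ((1 : ℝ) / N) *
        (T * (1 - (K : ℝ) ^ (-((1 : ℝ) / N)) - ε * (T / K))) ≤
      regret A (hiddenArmEnvironment N a ε) T := by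
  obtain ⟨a, ha⟩ := exists_expectedMass_le A (nullEnvironment K N) hK T
  have hK0 : (0 : ℝ) < K := by exact_mod_cast hK
  have hT0 : (0 : ℝ) < T := by exact_mod_cast hT
  have ha' : K * (expectedMass A (nullEnvironment K N) a T).toReal ≤ T := by
    simpa using ENNReal.toReal_mono (ENNReal.natCast_ne_top T) ha
  refine ⟨a, le_trans ?_ (le_regret_hiddenArm hN A a ε T)⟩
  refine mul_le_mul_of_nonneg_left ?_ (Real.rpow_nonneg ε.2.1 _)
  -- Division by `T` makes the statistic `[0,1]`-valued; multiplying back turns the error into `ε *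
  -- (T / K) * T`.
  have h1 := integral_historyLaw_hiddenArm_le A a ε T
    ((measurable_sum_strategy_rpow T a).div_const (T : ℝ))
    (fun h => div_nonneg (sum_strategy_rpow_nonneg h a) hT0.le)
    fun h => (div_le_one hT0).2 (sum_strategy_rpow_le h a)
  rw [integral_div, integral_div, div_le_iff₀ hT0, add_mul, div_mul_cancel₀ _ hT0.ne'] at h1
  have h2 := integral_sum_rpow_le hN hK A (nullEnvironment K N) a T ha'
  have h3 : (expectedMass A (nullEnvironment K N) a T).toReal ≤ T / K := by
    rw [le_div_iff₀ hK0, mul_comm]; exact ha'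
  have h4 : ε * (expectedMass A (nullEnvironment K N) a T).toReal * T ≤ ε * (T / K) * T := by
    have := ε.2.1
    gcongr
  linarith

/-! ### Choice of `ε` and conclusion. -/

theorem half_le_one_sub_exp_neg {x : ℝ} (hx : 0 ≤ x) (hx1 : x ≤ 1) :
    x / 2 ≤ 1 - Real.exp (-x) := by
  have h : Real.exp (-x) ≤ 1 / (1 + x) := by
    rw [Real.exp_neg, ← one_div]
    exact one_div_le_one_div_of_le (by linarith) (by linarith [Real.add_one_le_exp x])
  have h2 : 1 / (1 + x) ≤ 1 - x / 2 := by
    rw [div_le_iff₀ (by linarith)]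
    nlinarith
  linarith

/-- The choice `ε = x K / (4 T)` with `x = ln K / N`. -/
theorem exists_regret_lower_bound (hN : 1 ≤ N) (hK : 2 ≤ K) (hKN : Real.log K ≤ N)
    {T : ℕ} (hT : K ≤ T) (A : BanditAlgorithm K N) :
    ∃ (a : Fin K) (ε : unitInterval), (0 : ℝ) < ε ∧
      1 / 16 * ((Real.log K / N) ^ 2 * (K : ℝ) ^ ((1 : ℝ) / N) *
        (T : ℝ) ^ (((N : ℝ) - 1) / N)) ≤ regret A (hiddenArmEnvironment N a ε) T := by
  have hN1 : (1 : ℝ) ≤ N := by exact_mod_cast hN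
  have hN0 : (0 : ℝ) < N := by linarith
  have hK0 : (0 : ℝ) < K := by positivity
  have hKT : (K : ℝ) ≤ T := by exact_mod_cast hT
  have hT0 : (0 : ℝ) < T := by linarith
  set x : ℝ := Real.log K / N with hx
  have hx0 : 0 < x := div_pos (Real.log_pos (by exact_mod_cast hK)) hN0
  have hx1 : x ≤ 1 := (div_le_one hN0).2 hKN
  have hε0 : 0 < x / 4 * (K / T) := by positivity
  have hε1 : x / 4 * (K / T) ≤ 1 :=
    mul_le_one₀ (by linarith) (by positivity) ((div_le_one hT0).2 hKT)
  obtain ⟨a, ha⟩ := exists_le_regret_hiddenArm hN (by omega) A ⟨_, hε0.le, hε1⟩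
    (T := T) (by omega)
  refine ⟨a, ⟨_, hε0.le, hε1⟩, hε0, le_trans ?_ ha⟩
  have hexp : (K : ℝ) ^ (-((1 : ℝ) / N)) = Real.exp (-x) := by
    rw [Real.rpow_def_of_pos hK0, hx]; ring_nf
  -- This `ε` spends half of the available gap `x / 2` on the change of environment.
  have hgap : x / 4 ≤ 1 - (K : ℝ) ^ (-((1 : ℝ) / N)) - x / 4 * (K / T) * (T / K) := by
    have : x / 4 * ((K : ℝ) / T) * (T / K) = x / 4 := by field_simp
    rw [this, hexp]
    linarith [half_le_one_sub_exp_neg hx0.le hx1]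
  -- The root is bounded crudely, at the price of one factor `x`; the two factors `x / 4` together
  -- give the constant `1 / 16`.
  have hroot : x / 4 ≤ (x / 4) ^ ((1 : ℝ) / N) := by
    simpa using Real.rpow_le_rpow_of_exponent_ge (by positivity) (by linarith)
      ((div_le_one hN0).2 hN1)
  have hTpow : (T : ℝ) ^ (((N : ℝ) - 1) / N) = T / (T : ℝ) ^ ((1 : ℝ) / N) := by
    rw [sub_div, div_self hN0.ne', Real.rpow_sub hT0, Real.rpow_one]
  calc 1 / 16 * (x ^ 2 * (K : ℝ) ^ ((1 : ℝ) / N) * (T : ℝ) ^ (((N : ℝ) - 1) / N))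
      = x / 4 * ((K : ℝ) ^ ((1 : ℝ) / N) / (T : ℝ) ^ ((1 : ℝ) / N)) * (T * (x / 4)) := by
        rw [hTpow]; ring
    _ ≤ (x / 4) ^ ((1 : ℝ) / N) * ((K : ℝ) ^ ((1 : ℝ) / N) / (T : ℝ) ^ ((1 : ℝ) / N)) *
          (T * (1 - (K : ℝ) ^ (-((1 : ℝ) / N)) - x / 4 * (K / T) * (T / K))) := by
        gcongr
    _ = _ := by
        rw [Real.mul_rpow (by positivity) (by positivity), Real.div_rpow hK0.le hT0.le]

end NashBandit

theorem theorem2 :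
    ∃ c : ℝ, 0 < c ∧
      ∀ N K : ℕ, 1 ≤ N → 1 ≤ K → Real.log K ≤ N →
        ∃ T₀ : ℕ, ∀ T : ℕ, T₀ ≤ T →
          ∀ A : NashBandit.BanditAlgorithm K N,
            ∃ E : NashBandit.StochasticEnvironment K N,
              (∃ (a : Fin K) (ε : ℝ), 0 < ε ∧ ε ≤ 1 ∧
                E.mean = NashBandit.hiddenArmMean a ε) ∧
              c * (Real.log K ^ 3 / (N : ℝ) ^ 3 * (K : ℝ) ^ ((1 : ℝ) / N) *
                  (T : ℝ) ^ (((N : ℝ) - 1) / N)) ≤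
                NashBandit.regret A E T := by
  -- `T₀ = K` makes `K / T ≤ 1`, so that the chosen `ε` is a valid mean.
  refine ⟨1 / 16, by norm_num, fun N K hN hK hKN => ⟨K, fun T hT A => ?_⟩⟩
  -- For `K = 1` the logarithm vanishes and nonnegativity of the regret suffices.
  obtain rfl | hK2 := hK.eq_or_lt
  · refine ⟨hiddenArmEnvironment N 0 1, ⟨0, 1, one_pos, le_rfl, ?_⟩, ?_⟩
    · exact mean_hiddenArmEnvironment 0 1
    · simpa using regret_hiddenArm_nonneg hN A 0 1 T
  · obtain ⟨a, ε, hε, h⟩ := exists_regret_lower_bound hN hK2 hKN hT A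
    refine ⟨hiddenArmEnvironment N a ε,
      ⟨a, ε, hε, ε.2.2, mean_hiddenArmEnvironment a ε⟩, le_trans ?_ h⟩
    have hx0 : 0 ≤ Real.log K / N := div_nonneg (Real.log_natCast_nonneg K) (Nat.cast_nonneg N)
    have hx1 : Real.log K / N ≤ 1 := div_le_one_of_le₀ hKN (Nat.cast_nonneg N)
    rw [← div_pow]
    -- The square is weakened to the cube, as `ln K / N ≤ 1`.
    have := pow_le_pow_of_le_one hx0 hx1 (show 2 ≤ 3 by norm_num)
    gcongr
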